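/- Let $(\alpha,S)$ be a phase-type representation with $n$ phases ($\alpha$ a probability vector, $S$ a nonsingular sub-generator matrix), put $s^*=-S\mathbf 1$, and assume that the mean job size $\alpha(-S)^{-1}\mathbf 1$ equals $1$. Let $\delta>0$ and $y=\alpha(\delta I-S)^{-1}s^*$; thus $y=P[Z<X]$ for a job size $Z$ with this distribution and an independent exponential $X$ of rate $\delta$. For $\lambda\in(0,1)$ put $$\tilde m=\tilde m(\lambda)=\frac{\log\left(\frac1y+\left(\frac{\lambda}{\delta(1-\lambda)}-1\right)\frac{1-y}{y}\right)}{\log(1/y)} .$$ For an integer $m\ge 0$ and $\nu\ge 0$ consider the continuous-time Markov chain on the states $(q,e,j)$ with $e\in\{m,m+1\}$ (estimated queue length), $1\le q\le e$ (actual queue length) and $1\le j\le n$ (phase of the job in service), together with the states $(0,e)$ (empty queue), which has the following transitions. * Service: $(q,e,j)\to(q,e,j')$ at rate $S_{jj'}$ for $j'\ne j$; $(q,e,j)\to(q-1,e,j')$ at rate $s^*_j\alpha_{j'}$ if $q\ge 2$; $(1,e,j)\to(0,e)$ at rate $s^*_j$. * Probes: at rate $\delta$ the actual and the estimated queue length both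 become $\max(q,m)$. * Assignments: if $e=m$, at rate $\nu$ the actual queue length becomes $q+1$ and the estimated queue length becomes $m+1$. When a probe or an assignment makes an empty queue non-empty, the new phase is drawn from $\alpha$; otherwise these transitions keep the phase. A queue at the cavity of the push policy with arrival rate $\lambda$ consists of a pair $(m,\nu)$ and a stationary distribution of this chain under which the queue is empty with probability $1-\lambda$. Let $E[Q]$ be its mean (actual) queue length. Let $E[R]$ be the mean response time of the jobs that join it, served in order of arrival: a probe at actual length $q\le m$ brings $m-q$ jobs, at positions $q+1,\dots,m$; an assignment brings one job, at position $q+1$; and the mean is over all the jobs that join the stationary queue. Then for every $\lambda\in(0,1)$ such a queue at the cavity exists, and, whichever one is taken for each $\lambda$, $$\lim_{\lambda\to1^-}\frac{E[R]}{\log\left(\frac1{1-\lambda}\right)}=\lim_{\lambda\to1^-}\frac{E[Q]}{\log\left(\frac1{1-\lambda}\right)}=\lim_{\lambda\to1^-}\frac{\tilde m}{\log\left(\frac1{1-\lambda}\right)}=\frac1{\log(1/y)} .$$ -/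

import Mathlib

open Matrix

noncomputable section

/-- A phase-type representation `(α, S)` with `n` phases: `α` is the law of the initial phase, `S` is
the sub-generator of the phase process (`S j k`, `j ≠ k`, is the rate of the phase change `j → k`),
and `S` is nonsingular, i.e. every phase is transient. -/
structure PhaseType (n : ℕ) where
  α : Fin n → ℝ
  S : Matrix (Fin n) (Fin n) ℝ
  α_nonneg : ∀ j, 0 ≤ α j
  α_sum : ∑ j, α j = 1
  S_offDiag_nonneg : ∀ j k, j ≠ k → 0 ≤ S j k
  S_rowSum_nonpos : ∀ j, ∑ k, S j k ≤ 0
  S_det_isUnit : IsUnit S.det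

namespace PhaseType

variable {n : ℕ} (D : PhaseType n)

/-- Service completion rates `s* = -S 1`. -/
def exitRate : Fin n → ℝ := -(D.S *ᵥ 1)

/-- Mean remaining service time `((-S)⁻¹ 1)_j` of a job in phase `j`. -/
def residualMean : Fin n → ℝ := (-D.S)⁻¹ *ᵥ 1

/-- Mean job size `α (-S)⁻¹ 1`. -/
def mean : ℝ := D.α ⬝ᵥ D.residualMean

/-- `y = α (δ I - S)⁻¹ s*`, the probability that a job of this phase-type size is completed
before an independent exponential timer of rate `δ` expires. -/
def y (δ : ℝ) : ℝ := D.α ⬝ᵥ ((δ • (1 : Matrix (Fin n) (Fin n) ℝ) - D.S)⁻¹ *ᵥ D.exitRate)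

end PhaseType

/-- States of the queue at the cavity of the push policy, when estimated queue lengths are
`m` or `m + 1`. `Sum.inl i` is the empty queue with estimate `m + i`, written `(0, m + i)`;
`Sum.inr ⟨i, k, j⟩` is the state `(k + 1, m + i, j)`: actual length `k + 1 ∈ {1, …, m + i}`,
estimated length `m + i`, job in service in phase `j`. -/
abbrev CavityState (m n : ℕ) : Type := Fin 2 ⊕ (Σ i : Fin 2, Fin (m + i) × Fin n)

namespace CavityState

variable {m n : ℕ}

/-- Actual queue length. -/
def len : CavityState m n → ℕ
  | .inl _ => 0
  | .inr ⟨_, k, _⟩ => k + 1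

/-- Estimated queue length. -/
def est : CavityState m n → ℕ
  | .inl i => m + i
  | .inr ⟨i, _, _⟩ => m + i

end CavityState

open CavityState

section Rates

variable {n : ℕ} (D : PhaseType n) (δ ν : ℝ) (m : ℕ)

/-- Transitions due to service: phase changes, and completions (which lower the actual queue length
by one, keep the estimate, and start the next job, if any, in a phase drawn from `α`). -/
def serviceRate : CavityState m n → CavityState m n → ℝ
  | .inl _, _ => 0
  | .inr ⟨i, k, j⟩, .inl i' => if i = i' ∧ (k : ℕ) = 0 then D.exitRate j else 0
  | .inr ⟨i, k, j⟩, .inr ⟨i', k', j'⟩ =>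
      (if i = i' ∧ (k : ℕ) = k' ∧ j ≠ j' then D.S j j' else 0)
        + (if i = i' ∧ (k : ℕ) = k' + 1 then D.exitRate j * D.α j' else 0)

/-- `startOrKeep D s t` is the probability that the phase of `t` is the one that results when jobs
are added to the queue in state `s`: the phase is kept if the server is busy in `s`, is drawn from
`α` if the server is idle in `s` and busy in `t`, and there is no phase if `t` is empty. -/
def startOrKeep : CavityState m n → CavityState m n → ℝ
  | .inl _, .inl _ => 1
  | .inl _, .inr ⟨_, _, j'⟩ => D.α j'
  | .inr _, .inl _ => 0
  | .inr ⟨_, _, j⟩, .inr ⟨_, _, j'⟩ => if j = j' then 1 else 0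

/-- Transitions due to probes, at rate `δ`: `(q, e) → (max q m, max q m)`. -/
def probeRate (s t : CavityState m n) : ℝ :=
  if t.len = max s.len m ∧ t.est = max s.len m then δ * startOrKeep D m s t else 0

/-- Transitions due to assignments of single jobs, at rate `ν` when the estimate is `m`:
`(q, m) → (q + 1, m + 1)`. -/
def assignRate (s t : CavityState m n) : ℝ :=
  if s.est = m ∧ t.len = s.len + 1 ∧ t.est = m + 1 then ν * startOrKeep D m s t else 0

/-- All transition rates (a rate from a state to itself is immaterial, see `pushGenerator`). -/
def jumpRate (s t : CavityState m n) : ℝ :=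
  serviceRate D m s t + probeRate D δ m s t + assignRate D ν m s t

/-- The rate matrix `Q(m, ν)` of the queue at the cavity: off the diagonal its entries are the
transition rates, and its rows sum to zero. -/
def pushGenerator : Matrix (CavityState m n) (CavityState m n) ℝ :=
  Matrix.of (jumpRate D δ ν m) - Matrix.diagonal (fun s => ∑ t, jumpRate D δ ν m s t)

end Rates

/-- The queue at the cavity of the push policy with job sizes `D`, probe rate `δ` and arrival rate
`lam`: a pair `(m, ν)` and a stationary distribution `π` of the chain with rate matrix `Q(m, ν)`
such that the queue is empty with probability `1 - lam`. -/
structure CavityQueue {n : ℕ} (D : PhaseType n) (δ lam : ℝ) where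
  m : ℕ
  ν : ℝ
  ν_nonneg : 0 ≤ ν
  π : CavityState m n → ℝ
  π_nonneg : ∀ s, 0 ≤ π s
  π_sum : ∑ s, π s = 1
  stationary : π ᵥ* pushGenerator D δ ν m = 0
  empty_prob : ∑ s, (if s.len = 0 then π s else 0) = 1 - lam

/-- Mean time until the job at position `k` of the queue is completed (`k = 1` is the job in
service, jobs are served in order of arrival), when the current state is `s`; if the server
is idle in `s`, the positions are those of jobs that join the queue at this moment. -/
def meanSojourn {n : ℕ} (D : PhaseType n) {m : ℕ} (k : ℕ) : CavityState m n → ℝ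
  | .inl _ => k * D.mean
  | .inr ⟨_, _, j⟩ => D.residualMean j + ((k : ℝ) - 1) * D.mean

namespace CavityQueue

variable {n : ℕ} {D : PhaseType n} {δ lam : ℝ} (c : CavityQueue D δ lam)

/-- Mean queue length `E[Q]`. -/
def meanQueueLength : ℝ := ∑ s, c.π s * (s.len : ℝ)

/-- Mean number of jobs that join the queue per unit of time: a probe in a state with actual length
`q ≤ m` brings `m - q` jobs, an assignment brings one job. -/
def jobRate : ℝ :=
  ∑ s, c.π s * (δ * ((c.m - s.len : ℕ) : ℝ) + (if s.est = c.m then c.ν else 0))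

/-- Mean response time `E[R]` of a job: the expected time from joining the queue to completion,
averaged over the jobs that join the stationary queue. The jobs brought by a probe
take the positions `q + 1, …, m`, a single assigned job takes the position `q + 1`. -/
def meanResponseTime : ℝ :=
  (∑ s, c.π s * (δ * (∑ k ∈ Finset.Ioc s.len c.m, meanSojourn D k s)
      + (if s.est = c.m then c.ν * meanSojourn D (s.len + 1) s else 0))) / c.jobRate

end CavityQueue

/-- The number `m̃` attached to the arrival rate `lam`. -/
def mTilde {n : ℕ} (D : PhaseType n) (δ lam : ℝ) : ℝ :=
  Real.log (1 / D.y δ + (lam / (δ * (1 - lam)) - 1) * ((1 - D.y δ) / D.y δ))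
    / Real.log (1 / D.y δ)

end

/-!
For every function `f` on the states, a stationary distribution `π` satisfies `π ⬝ᵥ (Q *ᵥ f) = 0`.
The proof consists of this equation for five well-chosen `f`, which replaces the solution of the
chain. Functions are given as `(q, e, j) ↦ F q e j`; `sum_jumpRate_mul` computes the rate matrix on
them.

* The workload shows that jobs join at rate `lam` (`sum_joinRate_eq`), and the sum of the mean
  remaining sojourn times of the jobs present gives Little's law (`sum_joinSojourn_eq`). Hence
  `E[R] = E[Q] / lam`. As probes bring at most `lam` jobs per unit of time, the mean of `m - q` is
  at most `lam / δ`, so `E[Q]` differs from `m` by a bounded amount.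
* A function of the phase alone gives the mean, over the busy states, of the
  probability that the job in service is completed before the next probe (`sum_busyResidualY`). The probability that the queue empties before the next probe, if an
  assignment that is still possible is taken as made, gives with it the identity `empty_balance`:
  with `p = π(0, m) + π(0, m + 1)`,
  `(1 - y) (1 - p) y ^ m + δ y ^ (m + 1) p = δ (y π(0, m) + π(0, m + 1))`.
  As the right-hand side is between `δ y p` and `δ p`, the probability `p = 1 - lam` is within
  constant factors of `y ^ m`, so `m log (1 / y)` is `log (1 / (1 - lam))` up to a bounded amount.
* The indicator of the estimate `m + 1` shows `π(0, m + 1) = 0` if `ν = 0` and `π(0, m) ≤ δ / ν`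
  otherwise. With `empty_balance` this determines `p` at `ν = 0` and as `ν → ∞`; for
  a suitable `m` these values enclose `1 - lam`, and an intermediate value argument
  (`exists_stationary_mean_eq`) gives the queue at the cavity.

That `0 < y < 1` and that stationary distributions exist are consequences of the minimum principle
for sub-generators.
-/

/-! ### Minimum principle for sub-generators -/

section SubGenerator

variable {σ : Type*} [Fintype σ] {A : Matrix σ σ ℝ} {v : σ → ℝ} {ε : ℝ}

/-- A sub-generator is nonnegative at a minimum whose value is at most zero. -/
theorem mulVec_nonneg_of_argmin (hoff : ∀ s t, s ≠ t → 0 ≤ A s t) (hrow : ∀ s, ∑ t, A s t ≤ 0)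
    {s : σ} (hs : ∀ t, v s ≤ v t) (hv : v s ≤ 0) : 0 ≤ (A *ᵥ v) s := by
  have h1 : (A *ᵥ v) s = ∑ t, A s t * (v t - v s) + (∑ t, A s t) * v s := by
    simp only [mulVec, dotProduct, mul_sub, Finset.sum_sub_distrib, Finset.sum_mul]
    ring
  rw [h1]
  refine add_nonneg (Finset.sum_nonneg fun t _ => ?_) (mul_nonneg_of_nonpos_of_nonpos (hrow s) hv)
  by_cases h : s = t
  · simp [h]
  · exact mul_nonneg (hoff s t h) (sub_nonneg.2 (hs t))

theorem nonneg_of_mulVec_le (hoff : ∀ s t, s ≠ t → 0 ≤ A s t) (hrow : ∀ s, ∑ t, A s t ≤ 0)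
    (hε : 0 < ε) (h : ∀ s, (A *ᵥ v) s ≤ ε * v s) (s : σ) : 0 ≤ v s := by
  have : Nonempty σ := ⟨s⟩
  obtain ⟨s₀, hs₀⟩ := Finite.exists_min v
  by_contra hneg
  have hneg0 : v s₀ < 0 := lt_of_le_of_lt (hs₀ s) (not_le.1 hneg)
  have := mulVec_nonneg_of_argmin hoff hrow hs₀ hneg0.le
  nlinarith [h s₀]

theorem pos_of_mulVec_lt (hoff : ∀ s t, s ≠ t → 0 ≤ A s t) (hrow : ∀ s, ∑ t, A s t ≤ 0)
    (hε : 0 ≤ ε) (h : ∀ s, (A *ᵥ v) s < ε * v s) (s : σ) : 0 < v s := by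
  have : Nonempty σ := ⟨s⟩
  obtain ⟨s₀, hs₀⟩ := Finite.exists_min v
  by_contra hneg
  have hneg0 : v s₀ ≤ 0 := (hs₀ s).trans (not_lt.1 hneg)
  have := mulVec_nonneg_of_argmin hoff hrow hs₀ hneg0
  nlinarith [h s₀]

variable [DecidableEq σ]

theorem isUnit_det_smul_one_sub (hoff : ∀ s t, s ≠ t → 0 ≤ A s t) (hrow : ∀ s, ∑ t, A s t ≤ 0)
    (hε : 0 < ε) : IsUnit (ε • (1 : Matrix σ σ ℝ) - A).det := by
  rw [isUnit_iff_ne_zero]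
  intro h0
  obtain ⟨v, hv, h⟩ := exists_mulVec_eq_zero_iff.2 h0
  have h1 : A *ᵥ v = ε • v := by
    rw [sub_mulVec, smul_mulVec, one_mulVec] at h
    exact (sub_eq_zero.1 h).symm
  have h2 := nonneg_of_mulVec_le (v := v) hoff hrow hε (fun s => by simp [h1])
  have h3 := nonneg_of_mulVec_le (v := -v) hoff hrow hε (fun s => by simp [mulVec_neg, h1])
  exact hv (funext fun s => le_antisymm (by simpa using h3 s) (h2 s))

theorem inv_smul_one_sub_nonneg (hoff : ∀ s t, s ≠ t → 0 ≤ A s t)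
    (hrow : ∀ s, ∑ t, A s t ≤ 0) (hε : 0 < ε) (s t : σ) :
    0 ≤ (ε • (1 : Matrix σ σ ℝ) - A)⁻¹ s t := by
  set M := ε • (1 : Matrix σ σ ℝ) - A with hM
  have hu : IsUnit M.det := isUnit_det_smul_one_sub hoff hrow hε
  have h1 : M *ᵥ (fun s => M⁻¹ s t) = fun s => (1 : Matrix σ σ ℝ) s t := by
    rw [← mul_nonsing_inv M hu]
    rfl
  refine nonneg_of_mulVec_le (v := fun s => M⁻¹ s t) hoff hrow hε (fun r => ?_) s
  have h2 := congrFun h1 r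
  rw [hM, sub_mulVec, smul_mulVec, one_mulVec] at h2
  have h3 : 0 ≤ (1 : Matrix σ σ ℝ) r t := by
    rw [one_apply]
    split_ifs <;> norm_num
  simp only [Pi.sub_apply, Pi.smul_apply, smul_eq_mul] at h2
  rw [← hM] at h2
  linarith

end SubGenerator

/-! ### Stationary distributions with a prescribed mean -/

section Stationary

variable {σ : Type*} [Fintype σ] [DecidableEq σ]

/-- `ε e_r (ε I - Q)⁻¹`, the law of the chain with rate matrix `Q`, started in `r`, at an
exponential time of rate `ε`. -/
noncomputable def resolventLaw (Q : Matrix σ σ ℝ) (r : σ) (ε : ℝ) : σ → ℝ :=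
  fun s => ε * (ε • (1 : Matrix σ σ ℝ) - Q)⁻¹ r s

variable {Q : Matrix σ σ ℝ} {ε : ℝ}

theorem resolventLaw_mem_stdSimplex (hoff : ∀ s t, s ≠ t → 0 ≤ Q s t)
    (hrow : ∀ s, ∑ t, Q s t = 0) (hε : 0 < ε) (r : σ) :
    resolventLaw Q r ε ∈ stdSimplex ℝ σ := by
  have hu := isUnit_det_smul_one_sub hoff (fun s => (hrow s).le) hε
  refine ⟨fun s => mul_nonneg hε.le
    (inv_smul_one_sub_nonneg hoff (fun s => (hrow s).le) hε r s), ?_⟩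
  set M := ε • (1 : Matrix σ σ ℝ) - Q with hM
  have h1 : M *ᵥ (1 : σ → ℝ) = ε • 1 := by
    rw [hM, sub_mulVec, smul_mulVec, one_mulVec, sub_eq_self]
    ext s
    simp [mulVec, dotProduct, hrow]
  have h2 : M⁻¹ *ᵥ (ε • (1 : σ → ℝ)) = 1 := by
    rw [← h1, mulVec_mulVec, nonsing_inv_mul M hu, one_mulVec]
  have h3 := congrFun h2 r
  simpa [mulVec, dotProduct, resolventLaw, mul_comm] using h3

theorem resolventLaw_vecMul (hoff : ∀ s t, s ≠ t → 0 ≤ Q s t)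
    (hrow : ∀ s, ∑ t, Q s t = 0) (hε : 0 < ε) (r : σ) :
    resolventLaw Q r ε ᵥ* Q = ε • (resolventLaw Q r ε - Pi.single r 1) := by
  have hu := isUnit_det_smul_one_sub hoff (fun s => (hrow s).le) hε
  set M := ε • (1 : Matrix σ σ ℝ) - Q with hM
  have h0 : resolventLaw Q r ε = ε • (Pi.single r 1 ᵥ* M⁻¹) := by
    ext s
    simp [resolventLaw, hM]
  have h1 : resolventLaw Q r ε ᵥ* M = ε • Pi.single r 1 := by
    rw [h0, smul_vecMul, vecMul_vecMul, nonsing_inv_mul M hu, vecMul_one]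
  rw [smul_sub, ← h1, hM, vecMul_sub, vecMul_smul, vecMul_one]
  abel

theorem norm_resolventLaw_vecMul_le (hoff : ∀ s t, s ≠ t → 0 ≤ Q s t)
    (hrow : ∀ s, ∑ t, Q s t = 0) (hε : 0 < ε) (r : σ) :
    ‖resolventLaw Q r ε ᵥ* Q‖ ≤ ε := by
  obtain ⟨h0, h1⟩ := resolventLaw_mem_stdSimplex hoff hrow hε r
  rw [resolventLaw_vecMul hoff hrow hε r, pi_norm_le_iff_of_nonneg hε.le]
  intro s
  have h2 : resolventLaw Q r ε s ≤ 1 :=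
    h1 ▸ Finset.single_le_sum (fun t _ => h0 t) (Finset.mem_univ s)
  have h3 : |resolventLaw Q r ε s - Pi.single (M := fun _ => ℝ) r 1 s| ≤ 1 := by
    have := h0 s
    rw [Pi.single_apply, abs_le]
    split_ifs <;> constructor <;> linarith
  simp only [Pi.smul_apply, Pi.sub_apply, smul_eq_mul, Real.norm_eq_abs, abs_mul, abs_of_pos hε]
  nlinarith

/-- If the rate matrices `Q ν` depend continuously on `ν ∈ [a, b]`, and the stationary mean of `φ`
is at least `c` at `a` and at most `c` at `b`, then it equals `c` for some stationary distribution
at some `ν`. No uniqueness of the stationary distribution is needed: the intermediate value theorem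
is applied to the laws `resolventLaw (Q ν) r ε`, and `ε → 0` is a compactness argument. -/
theorem exists_stationary_mean_eq [Nonempty σ] {Q : ℝ → Matrix σ σ ℝ} {a b c : ℝ} (hab : a ≤ b)
    (hQ : Continuous Q) (hoff : ∀ ν ∈ Set.Icc a b, ∀ s t, s ≠ t → 0 ≤ Q ν s t)
    (hrow : ∀ ν, ∀ s, ∑ t, Q ν s t = 0) (φ : σ → ℝ)
    (ha : ∀ π ∈ stdSimplex ℝ σ, π ᵥ* Q a = 0 → c ≤ π ⬝ᵥ φ)
    (hb : ∀ π ∈ stdSimplex ℝ σ, π ᵥ* Q b = 0 → π ⬝ᵥ φ ≤ c) :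
    ∃ ν ∈ Set.Icc a b, ∃ π ∈ stdSimplex ℝ σ, π ᵥ* Q ν = 0 ∧ π ⬝ᵥ φ = c := by
  by_contra hcon
  push Not at hcon
  have hφ : Continuous fun x : ℝ × (σ → ℝ) => x.2 ⬝ᵥ φ := by
    simp only [dotProduct]
    fun_prop
  have hg : Continuous fun x : ℝ × (σ → ℝ) => ‖x.2 ᵥ* Q x.1‖ :=
    (continuous_snd.matrix_vecMul (hQ.comp continuous_fst)).norm
  -- On a closed set without stationary distributions, `‖π Q ν‖` is bounded away from zero.
  have key : ∀ C : Set (ℝ × (σ → ℝ)), IsClosed C →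
      (∀ x ∈ C, x.1 ∈ Set.Icc a b → x.2 ∈ stdSimplex ℝ σ → x.2 ᵥ* Q x.1 ≠ 0) →
      ∃ η > 0, ∀ x ∈ C, x.1 ∈ Set.Icc a b → x.2 ∈ stdSimplex ℝ σ → η ≤ ‖x.2 ᵥ* Q x.1‖ := by
    intro C hC hne
    have hK : IsCompact ((Set.Icc a b ×ˢ stdSimplex ℝ σ) ∩ C) :=
      (isCompact_Icc.prod (isCompact_stdSimplex ℝ σ)).inter_right hC
    rcases ((Set.Icc a b ×ˢ stdSimplex ℝ σ) ∩ C).eq_empty_or_nonempty with he | he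
    · refine ⟨1, one_pos, fun x hx h1 h2 => ?_⟩
      have : x ∈ (Set.Icc a b ×ˢ stdSimplex ℝ σ) ∩ C := ⟨⟨h1, h2⟩, hx⟩
      rw [he] at this
      exact this.elim
    · obtain ⟨x₀, ⟨⟨h1, h2⟩, h3⟩, hmin⟩ := hK.exists_isMinOn he hg.continuousOn
      exact ⟨_, norm_pos_iff.2 (hne x₀ h3 h1 h2), fun x hx h1 h2 => hmin ⟨⟨h1, h2⟩, hx⟩⟩
  have hamem : a ∈ Set.Icc a b := ⟨le_rfl, hab⟩
  have hbmem : b ∈ Set.Icc a b := ⟨hab, le_rfl⟩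
  obtain ⟨η₁, hη₁, hC₁⟩ := key ({x | x.1 = a} ∩ {x | x.2 ⬝ᵥ φ ≤ c})
    ((isClosed_eq continuous_fst continuous_const).inter (isClosed_le hφ continuous_const)) (by
      rintro ⟨ν, π⟩ ⟨rfl, hle⟩ _ hπ h0
      exact hcon _ hamem π hπ h0 (le_antisymm hle (ha π hπ h0)))
  obtain ⟨η₂, hη₂, hC₂⟩ := key ({x | x.1 = b} ∩ {x | c ≤ x.2 ⬝ᵥ φ})
    ((isClosed_eq continuous_fst continuous_const).inter (isClosed_le continuous_const hφ)) (by
      rintro ⟨ν, π⟩ ⟨rfl, hle⟩ _ hπ h0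
      exact hcon _ hbmem π hπ h0 (le_antisymm (hb π hπ h0) hle))
  obtain ⟨η₃, hη₃, hC₃⟩ := key {x | x.2 ⬝ᵥ φ = c} (isClosed_eq hφ continuous_const) (by
      rintro ⟨ν, π⟩ hc hν hπ h0
      exact hcon ν hν π hπ h0 hc)
  obtain ⟨r⟩ := ‹Nonempty σ›
  set ε := min η₁ (min η₂ η₃) / 2 with hεdef
  have hmin : 0 < min η₁ (min η₂ η₃) := lt_min hη₁ (lt_min hη₂ hη₃)
  have hε : 0 < ε := by positivity
  have hε₁ : ε < η₁ := by linarith [min_le_left η₁ (min η₂ η₃)]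
  have hε₂ : ε < η₂ := by linarith [min_le_right η₁ (min η₂ η₃), min_le_left η₂ η₃]
  have hε₃ : ε < η₃ := by linarith [min_le_right η₁ (min η₂ η₃), min_le_right η₂ η₃]
  have hmem : ∀ ν ∈ Set.Icc a b, resolventLaw (Q ν) r ε ∈ stdSimplex ℝ σ := fun ν hν =>
    resolventLaw_mem_stdSimplex (hoff ν hν) (hrow ν) hε r
  have hnorm : ∀ ν ∈ Set.Icc a b, ‖resolventLaw (Q ν) r ε ᵥ* Q ν‖ ≤ ε := fun ν hν =>
    norm_resolventLaw_vecMul_le (hoff ν hν) (hrow ν) hε r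
  have hlow : c < resolventLaw (Q a) r ε ⬝ᵥ φ := by
    by_contra hle
    have := hC₁ (a, resolventLaw (Q a) r ε) ⟨rfl, not_lt.1 hle⟩ hamem (hmem a hamem)
    linarith [hnorm a hamem]
  have hhigh : resolventLaw (Q b) r ε ⬝ᵥ φ < c := by
    by_contra hle
    have := hC₂ (b, resolventLaw (Q b) r ε) ⟨rfl, not_lt.1 hle⟩ hbmem (hmem b hbmem)
    linarith [hnorm b hbmem]
  have hcont : ContinuousOn (fun ν => resolventLaw (Q ν) r ε ⬝ᵥ φ) (Set.Icc a b) := by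
    have hM : Continuous fun ν => ε • (1 : Matrix σ σ ℝ) - Q ν := continuous_const.sub hQ
    simp only [dotProduct, resolventLaw]
    refine continuousOn_finsetSum _ fun s _ => ContinuousOn.mul (ContinuousOn.mul
      continuousOn_const ?_) continuousOn_const
    simp only [Matrix.inv_def, Ring.inverse_eq_inv', Matrix.smul_apply, smul_eq_mul]
    refine ContinuousOn.mul (ContinuousOn.inv₀ hM.matrix_det.continuousOn fun ν hν =>
      (isUnit_det_smul_one_sub (hoff ν hν) (fun s => (hrow ν s).le) hε).ne_zero)
      (hM.matrix_adjugate.matrix_elem r s).continuousOn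
  obtain ⟨ν, hν, hνc⟩ := intermediate_value_Icc' hab hcont ⟨hhigh.le, hlow.le⟩
  have := hC₃ (ν, resolventLaw (Q ν) r ε) hνc hν (hmem ν hν)
  linarith [hnorm ν hν]

end Stationary

/-! ### Transforms of a phase-type law -/

namespace PhaseType

variable {n : ℕ} (D : PhaseType n) {δ : ℝ}

/-- `((δ I - S)⁻¹ s*)_j`, the probability that a job in phase `j` is completed before an
independent exponential timer of rate `δ` expires. -/
noncomputable def residualY (δ : ℝ) : Fin n → ℝ :=
  (δ • (1 : Matrix (Fin n) (Fin n) ℝ) - D.S)⁻¹ *ᵥ D.exitRate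

theorem dotProduct_residualY : D.α ⬝ᵥ D.residualY δ = D.y δ := rfl

theorem S_mulVec_one : D.S *ᵥ 1 = -D.exitRate := by simp [exitRate]

theorem exitRate_nonneg (j : Fin n) : 0 ≤ D.exitRate j := by
  simpa [exitRate, mulVec, dotProduct] using D.S_rowSum_nonpos j

theorem S_mulVec_residualMean : D.S *ᵥ D.residualMean = -1 := by
  have hu : IsUnit (-D.S).det := by
    rw [det_neg]
    exact ((isUnit_one.neg).pow _).mul D.S_det_isUnit
  have : (-D.S) *ᵥ D.residualMean = 1 := by
    rw [residualMean, mulVec_mulVec, mul_nonsing_inv _ hu, one_mulVec]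
  rw [neg_mulVec] at this
  rw [← this, neg_neg]

theorem S_mulVec_residualY (hδ : 0 < δ) :
    D.S *ᵥ D.residualY δ = δ • D.residualY δ - D.exitRate := by
  have hu := isUnit_det_smul_one_sub D.S_offDiag_nonneg D.S_rowSum_nonpos hδ
  have : (δ • (1 : Matrix (Fin n) (Fin n) ℝ) - D.S) *ᵥ D.residualY δ = D.exitRate := by
    rw [residualY, mulVec_mulVec, mul_nonsing_inv _ hu, one_mulVec]
  rw [← this, sub_mulVec, smul_mulVec, one_mulVec, sub_sub_cancel]

theorem residualY_nonneg (hδ : 0 < δ) (j : Fin n) : 0 ≤ D.residualY δ j := by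
  refine nonneg_of_mulVec_le D.S_offDiag_nonneg D.S_rowSum_nonpos hδ (fun j => ?_) j
  simp [D.S_mulVec_residualY hδ, D.exitRate_nonneg]

theorem residualY_lt_one (hδ : 0 < δ) (j : Fin n) : D.residualY δ j < 1 := by
  have h := pos_of_mulVec_lt (v := 1 - D.residualY δ) D.S_offDiag_nonneg D.S_rowSum_nonpos hδ.le
    (fun j => by
      rw [mulVec_sub, D.S_mulVec_one, D.S_mulVec_residualY hδ]
      simp only [Pi.sub_apply, Pi.neg_apply, Pi.smul_apply, smul_eq_mul, Pi.one_apply]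
      linarith) j
  simpa using h

/-- Every phase can reach completion. The phases that cannot would form a closed class, on which
the mean residual service time has no minimum. -/
theorem residualY_pos (hδ : 0 < δ) (j : Fin n) : 0 < D.residualY δ j := by
  by_contra hj
  set J := Finset.univ.filter fun j => D.residualY δ j = 0 with hJ
  have hne : J.Nonempty := ⟨j, by
    simpa [hJ] using le_antisymm (not_lt.1 hj) (D.residualY_nonneg hδ j)⟩
  obtain ⟨i, hi, hmin⟩ := J.exists_min_image D.residualMean hne
  have hi0 : D.residualY δ i = 0 := by simpa [hJ] using hi
  have hterm : ∀ k, 0 ≤ D.S i k * D.residualY δ k := fun k => by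
    by_cases h : i = k
    · simp [← h, hi0]
    · exact mul_nonneg (D.S_offDiag_nonneg i k h) (D.residualY_nonneg hδ k)
  have hsum : ∑ k, D.S i k * D.residualY δ k = -D.exitRate i := by
    have := congrFun (D.S_mulVec_residualY hδ) i
    simpa [hi0, mulVec, dotProduct] using this
  have hexit : D.exitRate i = 0 :=
    le_antisymm (by linarith [Finset.sum_nonneg fun k (_ : k ∈ Finset.univ) => hterm k])
      (D.exitRate_nonneg i)
  rw [hexit, neg_zero, Finset.sum_eq_zero_iff_of_nonneg fun k _ => hterm k] at hsum
  have hrow : ∑ k, D.S i k = 0 := by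
    have := congrFun D.S_mulVec_one i
    simpa [mulVec, dotProduct, hexit] using this
  have hu : ∑ k, D.S i k * (D.residualMean k - D.residualMean i) = -1 := by
    have := congrFun D.S_mulVec_residualMean i
    simp only [mulVec, dotProduct, Pi.neg_apply, Pi.one_apply] at this
    simp only [mul_sub, Finset.sum_sub_distrib, ← Finset.sum_mul, hrow, this]
    ring
  have : 0 ≤ ∑ k, D.S i k * (D.residualMean k - D.residualMean i) := by
    refine Finset.sum_nonneg fun k _ => ?_
    rcases mul_eq_zero.1 (hsum k (Finset.mem_univ k)) with h | h
    · simp [h]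
    · by_cases hik : i = k
      · simp [hik]
      · exact mul_nonneg (D.S_offDiag_nonneg i k hik)
          (sub_nonneg.2 (hmin k (by simpa [hJ] using h)))
  linarith

theorem exists_α_pos : ∃ j, 0 < D.α j := by
  by_contra! h
  have := Finset.sum_nonpos fun j (_ : j ∈ Finset.univ) => h j
  linarith [D.α_sum]

theorem y_pos (hδ : 0 < δ) : 0 < D.y δ := by
  obtain ⟨j, hj⟩ := D.exists_α_pos
  exact Finset.sum_pos' (fun k _ => mul_nonneg (D.α_nonneg k) (D.residualY_nonneg hδ k))
    ⟨j, Finset.mem_univ j, mul_pos hj (D.residualY_pos hδ j)⟩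

theorem y_lt_one (hδ : 0 < δ) : D.y δ < 1 := by
  obtain ⟨j, hj⟩ := D.exists_α_pos
  rw [← D.α_sum]
  refine Finset.sum_lt_sum (fun k _ => ?_) ⟨j, Finset.mem_univ j, ?_⟩
  · exact mul_le_of_le_one_right (D.α_nonneg k) (D.residualY_lt_one hδ k).le
  · exact mul_lt_of_lt_one_right hj (D.residualY_lt_one hδ j)

end PhaseType

/-! ### The rate matrix acting on test functions -/

section Drift

variable {n : ℕ} (D : PhaseType n) (δ ν : ℝ) {m : ℕ} (F : ℕ → ℕ → Fin n → ℝ)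

/-- The mean of `F q e ·` after jobs are added to the queue in state `s`, so that its actual and
estimated lengths become `q` and `e`: the phase is kept if the server is busy in `s`, and is drawn
from `α` otherwise. -/
def valueAfterJoin (q e : ℕ) : CavityState m n → ℝ
  | .inl _ => D.α ⬝ᵥ F q e
  | .inr ⟨_, _, j⟩ => F q e j

/-- The function on states given by `(q, e, j) ↦ F q e j`, and by the average of `F 0 e` under `α`
in the state `(0, e)`. With this convention the departure of a job changes the value from `F q e j`
to the `α`-average of `F (q - 1) e`, whether or not the queue becomes empty. -/
def testFun (s : CavityState m n) : ℝ := valueAfterJoin D F s.len s.est s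

/-- The contribution of service to the rate matrix acting on `testFun D F`. -/
def serviceDrift : CavityState m n → ℝ
  | .inl _ => 0
  | .inr ⟨i, k, j⟩ => (D.S *ᵥ F (k + 1) (m + i)) j + D.exitRate j * (D.α ⬝ᵥ F k (m + i))

/-- The rate matrix acting on `testFun D F`. -/
def drift (s : CavityState m n) : ℝ :=
  serviceDrift D F s
    + δ * (valueAfterJoin D F (max s.len m) (max s.len m) s - testFun D F s)
    + (if s.est = m then ν * (valueAfterJoin D F (s.len + 1) (m + 1) s - testFun D F s) else 0)

theorem sum_startOrKeep_mul (s : CavityState m n) {q e : ℕ} (hqe : q ≤ e)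
    (he : e = m ∨ e = m + 1) (hs : 0 < s.len → 0 < q) (c x : ℝ) :
    ∑ t : CavityState m n, (if t.len = q ∧ t.est = e then c * startOrKeep D m s t else 0)
      * (testFun D F t - x) = c * (valueAfterJoin D F q e s - x) := by
  obtain ⟨i, rfl⟩ : ∃ i : Fin 2, e = m + i := by
    rcases he with rfl | rfl
    · exact ⟨0, rfl⟩
    · exact ⟨1, rfl⟩
  rw [Fintype.sum_sum_type]
  rcases q with _ | k
  · rcases s with i₀ | ⟨i₀, k₀, j₀⟩
    · simp [CavityState.len, CavityState.est, startOrKeep, testFun, valueAfterJoin, ite_mul]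
      fin_cases i <;> simp
    · exact absurd (hs (Nat.succ_pos _)) (lt_irrefl 0)
  · refine (congrArg₂ (· + ·)
      (Finset.sum_eq_zero fun i' _ => by simp [CavityState.len]) ?_).trans (zero_add _)
    rw [Fintype.sum_sigma, Finset.sum_eq_single i]
    · rw [Fintype.sum_prod_type, Finset.sum_eq_single (⟨k, hqe⟩ : Fin (m + i))]
      · rcases s with i₀ | ⟨i₀, k₀, j₀⟩
        · simp only [CavityState.len, CavityState.est, startOrKeep, testFun, valueAfterJoin]
          simp only [dotProduct, mul_sub, Finset.sum_sub_distrib, ← Finset.sum_mul]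
          simp [mul_assoc, ← Finset.mul_sum, D.α_sum]
        · simp [CavityState.len, CavityState.est, startOrKeep, testFun, valueAfterJoin]
      · rintro b - hb
        have : (b : ℕ) ≠ k := fun h => hb (Fin.ext h)
        simp [CavityState.len, this]
      · simp
    · rintro i' - hi'
      have : ¬ ((i' : ℕ) = i) := fun h => hi' (Fin.ext h)
      simp [CavityState.est, this]
    · simp

theorem sum_serviceRate_mul (s : CavityState m n) :
    ∑ t : CavityState m n, serviceRate D m s t * (testFun D F t - testFun D F s)
      = serviceDrift D F s := by
  rcases s with i | ⟨i, k, j⟩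
  · simp [serviceRate, serviceDrift]
  · have hrow : D.S j j = -D.exitRate j - ∑ j' ∈ Finset.univ.erase j, D.S j j' := by
      have := congrFun D.S_mulVec_one j
      simp only [mulVec, dotProduct, Pi.one_apply, mul_one, Pi.neg_apply] at this
      rw [← this, ← Finset.add_sum_erase _ _ (Finset.mem_univ j)]
      ring
    set x := F (k + 1) (m + i) j with hx
    have hphase : ∑ j', (if j ≠ j' then D.S j j' else 0) * (F (k + 1) (m + i) j' - x)
        = (D.S *ᵥ F (k + 1) (m + i)) j + D.exitRate j * x := by
      simp only [mulVec, dotProduct]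
      rw [← Finset.add_sum_erase _ _ (Finset.mem_univ j),
        ← Finset.add_sum_erase _ (fun j' => D.S j j' * F (k + 1) (m + i) j') (Finset.mem_univ j),
        hrow, ← hx]
      have : ∀ j' ∈ Finset.univ.erase j, (if j ≠ j' then D.S j j' else 0)
          * (F (k + 1) (m + i) j' - x) = D.S j j' * F (k + 1) (m + i) j' - D.S j j' * x := by
        intro j' hj'
        rw [if_pos (Finset.ne_of_mem_erase hj').symm, mul_sub]
      rw [Finset.sum_congr rfl this, Finset.sum_sub_distrib, ← Finset.sum_mul]
      simp
      ring
    have hjump : ∀ q, ∑ j', D.exitRate j * D.α j' * (F q (m + i) j' - x)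
        = D.exitRate j * (D.α ⬝ᵥ F q (m + i)) - D.exitRate j * x := by
      intro q
      simp only [dotProduct, mul_sub, Finset.sum_sub_distrib, ← Finset.sum_mul, ← Finset.mul_sum,
        D.α_sum, mul_assoc, one_mul]
    rw [Fintype.sum_sum_type, Fintype.sum_sigma, Finset.sum_eq_single i, Finset.sum_eq_single i]
    · rw [Fintype.sum_prod_type]
      simp only [serviceRate, serviceDrift, testFun, valueAfterJoin, CavityState.len,
        CavityState.est, true_and, add_mul, Finset.sum_add_distrib, ← hx]
      rw [Finset.sum_eq_single k]
      · simp only [true_and, hphase]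
        obtain ⟨k, hk⟩ := k
        rcases k with _ | k
        · simp [mul_sub]
          ring
        · rw [Finset.sum_eq_single (⟨k, by omega⟩ : Fin (m + i))]
          · simp [hjump]
          · rintro b - hb
            have : ¬ (k = (b : ℕ)) := fun h => hb (Fin.ext h.symm)
            simp [this]
          · simp
      · rintro b - hb
        have : ¬ ((k : ℕ) = b) := fun h => hb (Fin.ext h.symm)
        simp [this]
      · simp
    · rintro i' - hi'
      simp [serviceRate, hi'.symm]
    · simp
    · rintro i' - hi'
      simp [serviceRate, hi'.symm]
    · simp

theorem CavityState.len_le_est (s : CavityState m n) : s.len ≤ s.est := by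
  rcases s with i | ⟨i, k, j⟩
  · exact Nat.zero_le _
  · exact k.2

theorem CavityState.est_eq (s : CavityState m n) : s.est = m ∨ s.est = m + 1 := by
  have : ∀ i : Fin 2, m + (i : ℕ) = m ∨ m + (i : ℕ) = m + 1 := fun i => by omega
  rcases s with i | ⟨i, k, j⟩
  · exact this i
  · exact this i

theorem sum_jumpRate_mul (s : CavityState m n) :
    ∑ t, jumpRate D δ ν m s t * (testFun D F t - testFun D F s) = drift D δ ν F s := by
  simp only [jumpRate, add_mul, Finset.sum_add_distrib, sum_serviceRate_mul, drift]
  have hlen := s.len_le_est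
  congr 1
  · congr 1
    refine sum_startOrKeep_mul D F s le_rfl ?_ (fun h => lt_max_of_lt_left h) δ _
    rcases s.est_eq with h | h <;> omega
  · split_ifs with h
    · simp only [assignRate, h, true_and]
      exact sum_startOrKeep_mul D F s (by omega) (Or.inr rfl) (fun _ => Nat.succ_pos _) ν _
    · simp [assignRate, h]

theorem pushGenerator_mulVec (f : CavityState m n → ℝ) (s : CavityState m n) :
    (pushGenerator D δ ν m *ᵥ f) s = ∑ t, jumpRate D δ ν m s t * (f t - f s) := by
  rw [pushGenerator, sub_mulVec, Pi.sub_apply, mulVec_diagonal]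
  simp only [mulVec, dotProduct, of_apply, mul_sub, Finset.sum_sub_distrib, Finset.sum_mul]

theorem sum_stationary_mul_drift {π : CavityState m n → ℝ}
    (hπ : π ᵥ* pushGenerator D δ ν m = 0) : ∑ s, π s * drift D δ ν F s = 0 := by
  have h : π ⬝ᵥ (pushGenerator D δ ν m *ᵥ testFun D F) = 0 := by
    rw [dotProduct_mulVec, hπ, zero_dotProduct]
  simpa only [dotProduct, pushGenerator_mulVec, sum_jumpRate_mul] using h

theorem pushGenerator_row_sum (s : CavityState m n) : ∑ t, pushGenerator D δ ν m s t = 0 := by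
  simpa [mulVec, dotProduct] using pushGenerator_mulVec D δ ν (fun _ => (1 : ℝ)) s

theorem jumpRate_nonneg (hδ : 0 ≤ δ) (hν : 0 ≤ ν) (s t : CavityState m n) :
    0 ≤ jumpRate D δ ν m s t := by
  have hkeep : 0 ≤ startOrKeep D m s t := by
    rcases s with i | ⟨i, k, j⟩ <;> rcases t with i' | ⟨i', k', j'⟩ <;> simp only [startOrKeep]
    · exact zero_le_one
    · exact D.α_nonneg _
    · exact le_rfl
    · split_ifs <;> norm_num
  have hservice : 0 ≤ serviceRate D m s t := by
    rcases s with i | ⟨i, k, j⟩ <;> rcases t with i' | ⟨i', k', j'⟩ <;> simp only [serviceRate]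
    · exact le_rfl
    · exact le_rfl
    · split_ifs
      · exact D.exitRate_nonneg j
      · exact le_rfl
    · refine add_nonneg ?_ ?_ <;> split_ifs with h
      · exact D.S_offDiag_nonneg _ _ h.2.2
      · exact le_rfl
      · exact mul_nonneg (D.exitRate_nonneg _) (D.α_nonneg _)
      · exact le_rfl
  refine add_nonneg (add_nonneg hservice ?_) ?_
  · rw [probeRate]
    split_ifs
    exacts [mul_nonneg hδ hkeep, le_rfl]
  · rw [assignRate]
    split_ifs
    exacts [mul_nonneg hν hkeep, le_rfl]

theorem pushGenerator_offDiag_nonneg (hδ : 0 ≤ δ) (hν : 0 ≤ ν) (s t : CavityState m n)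
    (hst : s ≠ t) : 0 ≤ pushGenerator D δ ν m s t := by
  simp [pushGenerator, diagonal_apply_ne _ hst, jumpRate_nonneg D δ ν hδ hν]

theorem continuous_pushGenerator (m : ℕ) : Continuous fun ν => pushGenerator D δ ν m := by
  have h : ∀ s t, Continuous fun ν => jumpRate D δ ν m s t := fun s t => by
    simp only [jumpRate, assignRate]
    split_ifs <;> fun_prop
  refine Continuous.sub (continuous_matrix fun s t => h s t) (Continuous.matrix_diagonal ?_)
  exact continuous_pi fun s => continuous_finsetSum _ fun t _ => h s t

end Drift

/-! ### Balance equations of a stationary distribution -/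

section Balance

variable {n : ℕ} {D : PhaseType n} {δ ν : ℝ} {m : ℕ} {π : CavityState m n → ℝ}

theorem α_dotProduct_one : D.α ⬝ᵥ (1 : Fin n → ℝ) = 1 := by
  simpa [dotProduct] using D.α_sum

theorem sum_ite_len_eq_zero (π : CavityState m n → ℝ) :
    ∑ s : CavityState m n, (if s.len = 0 then π s else 0) = π (.inl 0) + π (.inl 1) := by
  rw [Fintype.sum_sum_type]
  simp [CavityState.len]

/-- The rate at which jobs join equals the busy probability: balance of the workload, whose mean in
state `(q, e, j)` is `residualMean j + q - 1`. -/
theorem sum_joinRate_eq (hD : D.mean = 1) (hsum : ∑ s, π s = 1)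
    (hπ : π ᵥ* pushGenerator D δ ν m = 0) :
    ∑ s, π s * (δ * ((m - s.len : ℕ) : ℝ) + (if s.est = m then ν else 0))
      = 1 - ∑ s : CavityState m n, (if s.len = 0 then π s else 0) := by
  set F : ℕ → ℕ → Fin n → ℝ := fun q _ => D.residualMean + ((q : ℝ) - 1) • 1 with hF
  have hα : ∀ q e, D.α ⬝ᵥ F q e = q := fun q e => by
    have h1 : D.α ⬝ᵥ D.residualMean = 1 := hD
    simp [hF, dotProduct_add, h1, α_dotProduct_one]
  have hmax : ∀ q : ℕ, ((max q m : ℕ) : ℝ) = q + ((m - q : ℕ) : ℝ) := fun q => by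
    rw [← Nat.cast_add]; congr 1; omega
  have hdrift : ∀ s : CavityState m n, drift D δ ν F s
      = (δ * ((m - s.len : ℕ) : ℝ) + (if s.est = m then ν else 0))
        - (1 - if s.len = 0 then 1 else 0) := by
    rintro (i | ⟨i, k, j⟩)
    · simp only [drift, testFun, valueAfterJoin, serviceDrift, hα, hmax]
      simp [CavityState.len]
    · have hS : (D.S *ᵥ F (k + 1) (m + i)) j = -1 - k * D.exitRate j := by
        simp [hF, mulVec_add, mulVec_smul, D.S_mulVec_residualMean, D.S_mulVec_one]
        ring
      simp only [drift, testFun, valueAfterJoin, serviceDrift, hα, hS]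
      simp only [hF, Pi.add_apply, Pi.smul_apply, Pi.one_apply, hmax]
      simp [CavityState.len]
      ring
  have h := sum_stationary_mul_drift D δ ν F hπ
  simp only [hdrift, mul_sub _ (_ + _), Finset.sum_sub_distrib, mul_sub _ (1 : ℝ), mul_one, hsum,
    mul_ite, mul_zero] at h
  simp only [mul_add, mul_ite, mul_zero] at h ⊢
  linarith

theorem sum_Ioc_eq_sub {G g : ℕ → ℝ} (h : ∀ k, G (k + 1) = G k + g (k + 1)) (a b : ℕ) :
    ∑ k ∈ Finset.Ioc a b, g k = G (max a b) - G a := by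
  rcases le_total b a with hab | hab
  · simp [hab]
  · induction b, hab using Nat.le_induction with
    | base => simp
    | succ b hb ih =>
      rw [Finset.sum_Ioc_succ_top (by omega), ih, max_eq_right hb, max_eq_right (by omega), h b]
      ring

/-- Little's law: balance of the sum of the mean remaining sojourn times of the jobs present. -/
theorem sum_joinSojourn_eq (hD : D.mean = 1) (hπ : π ᵥ* pushGenerator D δ ν m = 0) :
    ∑ s, π s * (δ * (∑ k ∈ Finset.Ioc s.len m, meanSojourn D k s)
      + (if s.est = m then ν * meanSojourn D (s.len + 1) s else 0))
      = ∑ s, π s * (s.len : ℝ) := by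
  set F : ℕ → ℕ → Fin n → ℝ :=
    fun q _ => (q : ℝ) • D.residualMean + ((q : ℝ) * (q - 1) / 2) • 1 with hF
  have hα : ∀ q e, D.α ⬝ᵥ F q e = q * (q + 1) / 2 := fun q e => by
    have h1 : D.α ⬝ᵥ D.residualMean = 1 := hD
    simp [hF, dotProduct_add, h1, α_dotProduct_one]
    ring
  have hstep : ∀ (s : CavityState m n) (e e' k : ℕ), valueAfterJoin D F (k + 1) e s
      = valueAfterJoin D F k e' s + meanSojourn D (k + 1) s := by
    rintro (i | ⟨i, k, j⟩) e e' q
    · simp only [valueAfterJoin, hα, meanSojourn, hD]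
      push_cast
      ring
    · simp [valueAfterJoin, hF, meanSojourn, hD]
      ring
  have hdrift : ∀ s : CavityState m n, drift D δ ν F s
      = (δ * (∑ k ∈ Finset.Ioc s.len m, meanSojourn D k s)
        + (if s.est = m then ν * meanSojourn D (s.len + 1) s else 0)) - s.len := by
    intro s
    have hserv : serviceDrift D F s = -s.len := by
      rcases s with i | ⟨i, k, j⟩
      · simp [serviceDrift, CavityState.len]
      · simp [serviceDrift, hα]
        simp [hF, mulVec_add, mulVec_smul, D.S_mulVec_residualMean, D.S_mulVec_one,
          CavityState.len]
        ring
    have hprobe : ∑ k ∈ Finset.Ioc s.len m, meanSojourn D k s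
        = valueAfterJoin D F (max s.len m) (max s.len m) s - testFun D F s :=
      sum_Ioc_eq_sub (G := fun q => valueAfterJoin D F q 0 s) (fun k => hstep s 0 0 k) s.len m
    rw [drift, hserv, hprobe, hstep s (m + 1) s.est s.len, ← testFun, add_sub_cancel_left]
    ring
  have h := sum_stationary_mul_drift D δ ν F hπ
  simp only [hdrift, mul_sub _ (_ + _), Finset.sum_sub_distrib] at h
  linarith

/-- `residualY` of the phase in service, and `0` in the states with an idle server. -/
noncomputable def busyResidualY (D : PhaseType n) (δ : ℝ) : CavityState m n → ℝ
  | .inl _ => 0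
  | .inr ⟨_, _, j⟩ => D.residualY δ j

/-- The stationary mean of `residualY` over the busy states depends on the queue length process only
through the busy probability: the test function `residualY + (1 - y) residualMean` of the phase has
`α`-average `1`, the value it takes in the idle states, so probes and assignments do not change
its mean. -/
theorem sum_busyResidualY (hD : D.mean = 1) (hδ : 0 < δ) (hsum : ∑ s, π s = 1)
    (hπ : π ᵥ* pushGenerator D δ ν m = 0) :
    δ * ∑ s, π s * busyResidualY D δ s
      = (1 - D.y δ) * (1 - ∑ s : CavityState m n, (if s.len = 0 then π s else 0)) := by
  set F : ℕ → ℕ → Fin n → ℝ := fun _ _ => D.residualY δ + (1 - D.y δ) • D.residualMean with hF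
  have hα : ∀ q e, D.α ⬝ᵥ F q e = 1 := fun q e => by
    have h1 : D.α ⬝ᵥ D.residualMean = 1 := hD
    simp [hF, dotProduct_add, h1, D.dotProduct_residualY]
  have hdrift : ∀ s : CavityState m n, drift D δ ν F s
      = δ * busyResidualY D δ s - (1 - D.y δ) * (1 - if s.len = 0 then 1 else 0) := by
    rintro (i | ⟨i, k, j⟩)
    · simp [drift, testFun, valueAfterJoin, serviceDrift, hα, busyResidualY, CavityState.len]
    · simp [drift, testFun, valueAfterJoin, serviceDrift, hα, busyResidualY, CavityState.len]
      simp [hF, mulVec_add, mulVec_smul, D.S_mulVec_residualMean, D.S_mulVec_residualY hδ]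
      ring
  have h := sum_stationary_mul_drift D δ ν F hπ
  have h2 : ∑ s, π s * drift D δ ν F s = δ * ∑ s, π s * busyResidualY D δ s
      - (1 - D.y δ) * (∑ s, π s - ∑ s : CavityState m n, (if s.len = 0 then π s else 0)) := by
    rw [← Finset.sum_sub_distrib, Finset.mul_sum, Finset.mul_sum, ← Finset.sum_sub_distrib]
    refine Finset.sum_congr rfl fun s _ => ?_
    rw [hdrift]
    split_ifs <;> ring
  rw [hsum] at h2
  linarith

/-- The test function is `y ^ (q - 1) ψ_j` for the estimate `m + 1`, and `y ^ q ψ_j` for the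
estimate `m`, where `ψ` is `residualY`: the probability that the queue empties before the next probe
once the pending assignment, if any, has been made. Assignments do not change it, and it
makes every probe bring the queue to the same value `y ^ m ψ_j`. -/
theorem empty_balance (hD : D.mean = 1) (hδ : 0 < δ) (hsum : ∑ s, π s = 1)
    (hπ : π ᵥ* pushGenerator D δ ν m = 0) :
    (1 - D.y δ) * (1 - (π (.inl 0) + π (.inl 1))) * D.y δ ^ m
        + δ * D.y δ ^ (m + 1) * (π (.inl 0) + π (.inl 1))
      = δ * (D.y δ * π (.inl 0) + π (.inl 1)) := by
  have hy := (D.y_pos hδ).ne'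
  set y := D.y δ with hydef
  set g : ℕ → ℝ := fun e => if e = m then 1 else y⁻¹ with hg
  set F : ℕ → ℕ → Fin n → ℝ := fun q e => (y ^ q * g e) • D.residualY δ with hF
  have hα : ∀ q e, D.α ⬝ᵥ F q e = y ^ q * g e * y := fun q e => by
    simp [hF, D.dotProduct_residualY, hydef]
  have hgm : g m = 1 := if_pos rfl
  have hgm1 : g (m + 1) = y⁻¹ := if_neg (by omega)
  -- A probe leads to the same value from every state, including those of length `m + 1`.
  have hmax : ∀ s : CavityState m n, y ^ (max s.len m) * g (max s.len m) = y ^ m := by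
    intro s
    have h1 := s.len_le_est
    rcases (show s.len ≤ m ∨ s.len = m + 1 by rcases s.est_eq with h | h <;> omega) with h | h
    · simp [max_eq_right h, hgm]
    · rw [h, max_eq_left (by omega), hgm1, pow_succ, mul_assoc, mul_inv_cancel₀ hy, mul_one]
  -- An assignment does not change the test function.
  have hassign : ∀ q, y ^ (q + 1) * g (m + 1) = y ^ q * g m := fun q => by
    rw [hgm1, hgm, pow_succ, mul_assoc, mul_inv_cancel₀ hy]
  have hinl : ∀ i : Fin 2, drift D δ ν F (.inl i : CavityState m n)
      = δ * (y ^ (m + 1) - g (m + i) * y) := by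
    intro i
    have h1 := hmax (.inl i)
    have h2 := hassign 0
    rw [drift]
    simp only [testFun, valueAfterJoin, serviceDrift, hα, h1]
    simp only [CavityState.len, CavityState.est, pow_zero, one_mul] at h2 ⊢
    split_ifs with h
    · rw [h2, h]; ring
    · ring
  have hinr : ∀ x : Σ i : Fin 2, Fin (m + i) × Fin n, drift D δ ν F (.inr x : CavityState m n)
      = δ * y ^ m * busyResidualY D δ (.inr x : CavityState m n) := by
    rintro ⟨i, k, j⟩
    have h1 := hmax (.inr ⟨i, k, j⟩)
    have h2 := hassign (k + 1)
    have hS : (D.S *ᵥ F (k + 1) (m + i)) j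
        = y ^ ((k : ℕ) + 1) * g (m + i) * (δ * D.residualY δ j - D.exitRate j) := by
      simp only [hF, mulVec_smul, D.S_mulVec_residualY hδ, Pi.smul_apply, Pi.sub_apply,
        smul_eq_mul]
    have h3 : (if CavityState.est (.inr ⟨i, k, j⟩ : CavityState m n) = m then
        ν * (valueAfterJoin D F (CavityState.len (.inr ⟨i, k, j⟩ : CavityState m n) + 1) (m + 1)
          (.inr ⟨i, k, j⟩ : CavityState m n) - testFun D F (.inr ⟨i, k, j⟩)) else 0) = 0 := by
      split_ifs with h
      · simp only [testFun, h, valueAfterJoin]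
        simp only [hF, Pi.smul_apply, smul_eq_mul, CavityState.len, h2]
        ring
      · rfl
    rw [drift, h3]
    simp only [testFun, valueAfterJoin, serviceDrift, hα, hS]
    simp only [hF, Pi.smul_apply, smul_eq_mul, h1, busyResidualY]
    simp only [CavityState.len, CavityState.est]
    ring
  have h := sum_stationary_mul_drift D δ ν F hπ
  have hb := sum_busyResidualY hD hδ hsum hπ
  rw [sum_ite_len_eq_zero, Fintype.sum_sum_type] at hb
  rw [Fintype.sum_sum_type] at h
  simp only [hinl, hinr, Fin.sum_univ_two] at h
  have h3 : ∑ x : Σ i : Fin 2, Fin (m + i) × Fin n,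
      π (.inr x) * (δ * y ^ m * busyResidualY D δ (.inr x : CavityState m n))
      = y ^ m * (δ * ∑ x : Σ i : Fin 2, Fin (m + i) × Fin n,
        π (.inr x) * busyResidualY D δ (.inr x : CavityState m n)) := by
    rw [Finset.mul_sum, Finset.mul_sum]
    exact Finset.sum_congr rfl fun x _ => by ring
  simp only [busyResidualY, mul_zero, Finset.sum_const_zero, zero_add] at hb h3 h
  rw [h3, hb] at h
  simp only [Fin.val_zero, Fin.val_one, add_zero, hgm, hgm1, inv_mul_cancel₀ hy, one_mul] at h
  linear_combination h

/-- Balance of the probability that the estimate is `m + 1`. -/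
theorem est_balance (hπ : π ᵥ* pushGenerator D δ ν m = 0) :
    ∑ s, π s * (δ * ((if max s.len m = m then 0 else 1) - (if s.est = m then 0 else 1))
      + (if s.est = m then ν else 0)) = 0 := by
  obtain ⟨g, hg⟩ : ∃ g : ℕ → ℝ, ∀ e, g e = if e = m then 0 else 1 := ⟨_, fun _ => rfl⟩
  have hv : ∀ (q e : ℕ) (s : CavityState m n),
      valueAfterJoin D (fun _ e => g e • (1 : Fin n → ℝ)) q e s = g e := by
    rintro q e (i | ⟨i, k, j⟩) <;> simp [valueAfterJoin, α_dotProduct_one]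
  have hserv : ∀ s : CavityState m n,
      serviceDrift D (fun _ e => g e • (1 : Fin n → ℝ)) s = 0 := by
    rintro (i | ⟨i, k, j⟩)
    · rfl
    · simp [serviceDrift, mulVec_smul, D.S_mulVec_one, α_dotProduct_one]
      ring
  refine Eq.trans (Finset.sum_congr rfl fun s _ => ?_)
    (sum_stationary_mul_drift D δ ν (fun _ e => g e • 1) hπ)
  rw [drift, hserv, testFun, hv, hv, hv, ← hg, ← hg, zero_add]
  congr 2
  split_ifs with h
  · rw [h, hg, hg, if_neg (by omega), if_pos rfl]
    ring
  · rfl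

/-- Without assignments the estimate `m + 1` is never taken while the queue is empty. -/
theorem empty_est_succ_eq_zero (hδ : 0 < δ) (h0 : ∀ s, 0 ≤ π s)
    (hπ : π ᵥ* pushGenerator D δ 0 m = 0) : π (.inl 1) = 0 := by
  have h := est_balance hπ
  have hle : ∀ s ∈ Finset.univ, π s * (δ * ((if max s.len m = m then 0 else 1)
      - (if s.est = m then 0 else 1)) + (if s.est = m then 0 else 0)) ≤ 0 := by
    intro s _
    refine mul_nonpos_of_nonneg_of_nonpos (h0 s) ?_
    have h1 := s.len_le_est
    split_ifs <;> first | omega | nlinarith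
  have h1 := (Finset.sum_eq_zero_iff_of_nonpos hle).1 h (.inl 1) (Finset.mem_univ _)
  simpa [CavityState.len, CavityState.est, hδ.ne'] using h1

/-- The estimate leaves `m` at rate `ν`, and returns to it at rate at most `δ`. -/
theorem mul_empty_est_le (hδ : 0 < δ) (hν : 0 ≤ ν) (h0 : ∀ s, 0 ≤ π s) (hsum : ∑ s, π s = 1)
    (hπ : π ᵥ* pushGenerator D δ ν m = 0) : ν * π (.inl 0) ≤ δ := by
  have h := est_balance hπ
  have hle : ∀ s ∈ Finset.univ, (if s = .inl 0 then ν * π s else 0) - δ * π s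
      ≤ π s * (δ * ((if max s.len m = m then 0 else 1)
      - (if s.est = m then 0 else 1)) + (if s.est = m then ν else 0)) := by
    intro s _
    have hs := h0 s
    have h3 : s = .inl 0 → s.est = m := by rintro rfl; rfl
    have hp := mul_nonneg hs hν
    have hq := mul_nonneg hs hδ.le
    split_ifs <;> first | (exfalso; tauto) | nlinarith
  have h1 := Finset.sum_le_sum hle
  rw [h, Finset.sum_sub_distrib, ← Finset.mul_sum, hsum] at h1
  simp at h1
  exact h1

end Balance

/-! ### Existence -/

section Existence

variable {n : ℕ} {D : PhaseType n} {δ lam : ℝ}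

/-- The second inequality holds for large `m`, as `y ^ m → 0`; the first is, up to a factor `y`,
the failure of the second for `m - 1`. -/
theorem exists_threshold {y p δ : ℝ} (hy0 : 0 < y) (hy1 : y < 1) (hp : 0 < p)
    (hp1 : p < 1) (hδ : 0 < δ) :
    ∃ m : ℕ, δ * p * (y - y ^ (m + 1)) ≤ (1 - p) * (1 - y) * y ^ m ∧
      (1 - p) * (1 - y) * y ^ m < δ * p * (1 - y ^ (m + 1)) := by
  have hex : ∃ m : ℕ, (1 - p) * (1 - y) * y ^ m < δ * p * (1 - y ^ (m + 1)) := by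
    have h1 := tendsto_pow_atTop_nhds_zero_of_lt_one hy0.le hy1
    have h2 : Filter.Tendsto (fun m : ℕ => δ * p * (1 - y ^ (m + 1)) - (1 - p) * (1 - y) * y ^ m)
        Filter.atTop (nhds (δ * p * (1 - 0) - (1 - p) * (1 - y) * 0)) :=
      (((Filter.tendsto_add_atTop_iff_nat 1).2 h1).const_sub 1 |>.const_mul (δ * p)).sub
        (h1.const_mul _)
    have h3 : (0 : ℝ) < δ * p * (1 - 0) - (1 - p) * (1 - y) * 0 := by
      have := mul_pos hδ hp
      linarith
    obtain ⟨m, hm⟩ := (h2.eventually (lt_mem_nhds h3)).exists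
    exact ⟨m, sub_pos.1 hm⟩
  classical
  refine ⟨Nat.find hex, ?_, Nat.find_spec hex⟩
  rcases h : Nat.find hex with _ | k
  · have h1 : δ * p * (y - y ^ (0 + 1)) = 0 := by ring
    have h2 : 0 ≤ (1 - p) * (1 - y) := mul_nonneg (by linarith) (by linarith)
    rw [h1, pow_zero, mul_one]
    exact h2
  · have h1 := not_lt.1 (Nat.find_min hex (m := k) (by omega))
    have h2 := mul_le_mul_of_nonneg_left h1 hy0.le
    calc _ = y * (δ * p * (1 - y ^ (k + 1))) := by ring
      _ ≤ _ := h2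
      _ = _ := by ring

/-- By `empty_balance`, the probability `p` of an empty queue satisfies
`δ p (y - y ^ (m + 1)) = (1 - p) (1 - y) y ^ m` at `ν = 0`, and approximately
`δ p (1 - y ^ (m + 1)) = (1 - p) (1 - y) y ^ m` for large `ν`. The choice of `m` in
`exists_threshold` puts `1 - lam` between the two solutions. -/
theorem nonempty_cavityQueue (hD : D.mean = 1) (hδ : 0 < δ) (hlam : lam ∈ Set.Ioo (0 : ℝ) 1) :
    Nonempty (CavityQueue D δ lam) := by
  have hy0 := D.y_pos hδ
  have hy1 := D.y_lt_one hδ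
  obtain ⟨hl0, hl1⟩ := hlam
  obtain ⟨m, hm1, hm2⟩ := exists_threshold hy0 hy1 (sub_pos.2 hl1) (by linarith) hδ
  set p := 1 - lam with hp
  have hp0 : 0 < p := by linarith
  set η := δ * p * (1 - D.y δ ^ (m + 1)) - (1 - p) * (1 - D.y δ) * D.y δ ^ m with hη
  have hη0 : 0 < η := sub_pos.2 hm2
  have hpow : 0 < D.y δ ^ m := pow_pos hy0 m
  have hpow1 : D.y δ ^ (m + 1) < 1 := pow_lt_one₀ hy0.le hy1 (by omega)
  have hpow2 : D.y δ ^ (m + 1) ≤ D.y δ := by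
    rw [pow_succ]
    exact mul_le_of_le_one_left hy0.le (pow_le_one₀ hy0.le hy1.le)
  have hφ : ∀ π : CavityState m n → ℝ, π ⬝ᵥ (fun s => if s.len = 0 then (1 : ℝ) else 0)
      = π (.inl 0) + π (.inl 1) := fun π => by
    rw [← sum_ite_len_eq_zero]
    simp [dotProduct]
  -- At the right end `ν π(0, m) ≤ δ` makes `π(0, m)` small enough.
  obtain ⟨ν, hν, π, hπ, hst, hmean⟩ := exists_stationary_mean_eq (a := 0) (b := δ ^ 2 / η) (c := p)
    (by positivity) (continuous_pushGenerator D δ m)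
    (fun ν hν => pushGenerator_offDiag_nonneg D δ ν hδ.le hν.1)
    (fun ν => pushGenerator_row_sum D δ ν) (fun s => if s.len = 0 then (1 : ℝ) else 0) (by
      rintro π ⟨h0, h1⟩ hst
      rw [hφ]
      have hb := empty_balance hD hδ h1 hst
      rw [empty_est_succ_eq_zero hδ h0 hst, add_zero, add_zero] at *
      by_contra hlt
      rw [not_le] at hlt
      have e1 : (1 - D.y δ) * D.y δ ^ m * π (.inl 0) < (1 - D.y δ) * D.y δ ^ m * p :=
        mul_lt_mul_of_pos_left hlt (mul_pos (by linarith) hpow)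
      have e2 : δ * (D.y δ - D.y δ ^ (m + 1)) * π (.inl 0)
          ≤ δ * (D.y δ - D.y δ ^ (m + 1)) * p :=
        mul_le_mul_of_nonneg_left hlt.le (mul_nonneg hδ.le (by linarith))
      nlinarith) (by
      rintro π ⟨h0, h1⟩ hst
      rw [hφ]
      have hb := empty_balance hD hδ h1 hst
      have hs := mul_empty_est_le hδ (by positivity) h0 h1 hst
      rw [div_mul_eq_mul_div, div_le_iff₀ hη0] at hs
      have hs' : δ * π (.inl 0) ≤ η := by
        refine le_of_mul_le_mul_left ?_ hδ
        linarith
      by_contra hlt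
      rw [not_le] at hlt
      set P := π (.inl 0) + π (.inl 1) with hP
      have e1 : (1 - D.y δ) * D.y δ ^ m * p < (1 - D.y δ) * D.y δ ^ m * P :=
        mul_lt_mul_of_pos_left hlt (mul_pos (by linarith) hpow)
      have e2 : δ * (1 - D.y δ ^ (m + 1)) * p ≤ δ * (1 - D.y δ ^ (m + 1)) * P :=
        mul_le_mul_of_nonneg_left hlt.le (mul_nonneg hδ.le (by linarith))
      have e3 : δ * (D.y δ * π (.inl 0) + π (.inl 1))
          = δ * P - (1 - D.y δ) * (δ * π (.inl 0)) := by rw [hP]; ring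
      have e4 : (1 - D.y δ) * (δ * π (.inl 0)) ≤ (1 - D.y δ) * η :=
        mul_le_mul_of_nonneg_left hs' (by linarith)
      have e5 : (1 - D.y δ) * η < η := by nlinarith
      rw [e3] at hb
      linarith)
  exact ⟨⟨m, ν, hν.1, π, hπ.1, hπ.2, hst, by rw [sum_ite_len_eq_zero, ← hφ, hmean]⟩⟩

end Existence

/-! ### Heavy traffic asymptotics -/

section Asymptotics

open Filter Topology

variable {n : ℕ} {D : PhaseType n} {δ lam : ℝ}

namespace CavityQueue

variable (c : CavityQueue D δ lam)

theorem jobRate_eq (hD : D.mean = 1) : c.jobRate = lam := by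
  rw [jobRate, sum_joinRate_eq hD c.π_sum c.stationary, c.empty_prob, sub_sub_cancel]

theorem meanResponseTime_eq (hD : D.mean = 1) :
    c.meanResponseTime = c.meanQueueLength / lam := by
  rw [meanResponseTime, c.jobRate_eq hD, sum_joinSojourn_eq hD c.stationary, meanQueueLength]

theorem meanQueueLength_le : c.meanQueueLength ≤ c.m + 1 := by
  calc c.meanQueueLength ≤ ∑ s, c.π s * ((c.m : ℝ) + 1) := by
        refine Finset.sum_le_sum fun s _ => mul_le_mul_of_nonneg_left ?_ (c.π_nonneg s)
        have h : s.len ≤ c.m + 1 := by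
          have := s.len_le_est
          rcases s.est_eq with h | h <;> omega
        exact_mod_cast h
    _ = c.m + 1 := by rw [← Finset.sum_mul, c.π_sum, one_mul]

/-- Probes bring `m - q` jobs at rate `δ`, and jobs join at rate `lam`, so the mean of `m - q` is
bounded. -/
theorem le_meanQueueLength (hD : D.mean = 1) (hδ : 0 < δ) :
    c.m - lam / δ ≤ c.meanQueueLength := by
  have h1 : ∑ s, c.π s * (δ * ((c.m : ℝ) - s.len)) ≤ c.jobRate := by
    refine Finset.sum_le_sum fun s _ => mul_le_mul_of_nonneg_left ?_ (c.π_nonneg s)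
    have h2 : (c.m : ℝ) - s.len ≤ ((c.m - s.len : ℕ) : ℝ) := by
      rw [sub_le_iff_le_add]
      exact_mod_cast le_tsub_add
    have h3 : (0 : ℝ) ≤ if s.est = c.m then c.ν else 0 := by
      split_ifs
      exacts [c.ν_nonneg, le_rfl]
    nlinarith
  have h2 : ∑ s, c.π s * (δ * ((c.m : ℝ) - s.len)) = δ * (c.m - c.meanQueueLength) := by
    simp only [mul_sub, mul_left_comm _ δ, Finset.sum_sub_distrib, ← Finset.mul_sum,
      ← Finset.sum_mul, c.π_sum, one_mul, meanQueueLength]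
  rw [c.jobRate_eq hD, h2] at h1
  have : c.m - c.meanQueueLength ≤ lam / δ := by
    rw [le_div_iff₀ hδ]
    linarith
  linarith

/-- Both bounds come from `empty_balance`, whose right-hand side lies between `δ y (1 - lam)` and
`δ (1 - lam)`. -/
theorem empty_prob_bounds (hD : D.mean = 1) (hδ : 0 < δ) :
    (1 - D.y δ) / δ * lam * D.y δ ^ c.m ≤ 1 - lam ∧
      D.y δ * (1 - lam) ≤ ((1 - D.y δ) / δ * lam + D.y δ * (1 - lam)) * D.y δ ^ c.m := by
  have hb := empty_balance hD hδ c.π_sum c.stationary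
  have he := c.empty_prob
  rw [sum_ite_len_eq_zero] at he
  rw [he] at hb
  have h0 := c.π_nonneg (.inl 0)
  have h1 := c.π_nonneg (.inl 1)
  have hy0 := D.y_pos hδ
  have hy1 := D.y_lt_one hδ
  have hp : 0 ≤ 1 - lam := by linarith
  have hb' : (1 - D.y δ) / δ * lam * D.y δ ^ c.m + D.y δ ^ (c.m + 1) * (1 - lam)
      = D.y δ * c.π (.inl 0) + c.π (.inl 1) := by
    field_simp
    linear_combination hb
  have h2 : 0 ≤ D.y δ ^ (c.m + 1) * (1 - lam) := by positivity
  constructor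
  · nlinarith
  · rw [pow_succ] at hb'
    nlinarith

/-- The threshold `m` differs from `log (1 / (1 - lam)) / log (1 / y)` by a bounded amount. -/
theorem abs_m_mul_log_sub_le (hD : D.mean = 1) (hδ : 0 < δ) (hlam : lam ∈ Set.Ico (1 / 2 : ℝ) 1) :
    |c.m * Real.log (1 / D.y δ) - Real.log (1 / (1 - lam))|
      ≤ |Real.log ((1 - D.y δ) / δ / 2)| + |Real.log (((1 - D.y δ) / δ + D.y δ) / D.y δ)| := by
  obtain ⟨hlow, hhigh⟩ := c.empty_prob_bounds hD hδ
  obtain ⟨hl0, hl1⟩ := hlam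
  have hy0 := D.y_pos hδ
  have hy1 := D.y_lt_one hδ
  set y := D.y δ
  set a := (1 - y) / δ with ha
  have ha0 : 0 < a := div_pos (by linarith) hδ
  have hp : 0 < 1 - lam := by linarith
  have hpow : 0 < y ^ c.m := pow_pos hy0 _
  have h1 : a / 2 * y ^ c.m ≤ 1 - lam := by
    refine le_trans (mul_le_mul_of_nonneg_right ?_ hpow.le) hlow
    nlinarith
  have h2 : 1 - lam ≤ (a + y) / y * y ^ c.m := by
    rw [div_mul_eq_mul_div, le_div_iff₀ hy0]
    have : a * lam + y * (1 - lam) ≤ a + y := by nlinarith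
    nlinarith
  have h3 := Real.log_le_log (by positivity) h1
  have h4 := Real.log_le_log hp h2
  rw [Real.log_mul (by positivity) hpow.ne', Real.log_pow] at h3 h4
  rw [one_div, one_div, Real.log_inv, Real.log_inv, abs_le]
  have h5 := neg_abs_le (Real.log (a / 2))
  have h6 := le_abs_self (Real.log ((a + y) / y))
  have h7 := abs_nonneg (Real.log (a / 2))
  have h8 := abs_nonneg (Real.log ((a + y) / y))
  constructor <;> nlinarith

end CavityQueue

theorem tendsto_log_one_div_one_sub :
    Tendsto (fun lam : ℝ => Real.log (1 / (1 - lam))) (𝓝[<] 1) atTop := by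
  refine Real.tendsto_log_atTop.comp ?_
  simp only [one_div]
  refine tendsto_inv_nhdsGT_zero.comp (tendsto_nhdsWithin_iff.2 ⟨?_, ?_⟩)
  · have : Tendsto (fun lam : ℝ => 1 - lam) (𝓝 1) (𝓝 (1 - 1)) :=
      (continuous_const.sub continuous_id).tendsto 1
    rw [sub_self] at this
    exact this.mono_left nhdsWithin_le_nhds
  · filter_upwards [self_mem_nhdsWithin] with lam hlam
    exact sub_pos.2 (Set.mem_Iio.1 hlam)

theorem tendsto_div_of_abs_sub_le {f Λ : ℝ → ℝ} {l : Filter ℝ} {L K : ℝ} (hL : 0 < L)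
    (hΛ : Tendsto Λ l atTop) (h : ∀ᶠ x in l, |f x * L - Λ x| ≤ K) :
    Tendsto (fun x => f x / Λ x) l (𝓝 (1 / L)) := by
  rw [← tendsto_sub_nhds_zero_iff]
  refine squeeze_zero_norm' ?_ ((hΛ.const_div_atTop (K / L)))
  filter_upwards [h, hΛ.eventually_gt_atTop 0] with x hx hpos
  have : f x / Λ x - 1 / L = (f x * L - Λ x) / L / Λ x := by
    field_simp
  rw [this, Real.norm_eq_abs, abs_div, abs_div, abs_of_pos hL, abs_of_pos hpos]
  gcongr

theorem eventually_mem_Ico_half : ∀ᶠ lam : ℝ in 𝓝[<] 1, lam ∈ Set.Ico (1 / 2 : ℝ) 1 := by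
  exact Ico_mem_nhdsLT (by norm_num)

theorem log_one_div_y_pos (hδ : 0 < δ) : 0 < Real.log (1 / D.y δ) :=
  Real.log_pos ((one_lt_div (D.y_pos hδ)).2 (D.y_lt_one hδ))

theorem tendsto_mTilde_div_log (D : PhaseType n) (hδ : 0 < δ) :
    Tendsto (fun lam => mTilde D δ lam / Real.log (1 / (1 - lam))) (𝓝[<] 1)
      (𝓝 (1 / Real.log (1 / D.y δ))) := by
  have hL := log_one_div_y_pos (D := D) hδ
  have hy0 := D.y_pos hδ
  have hy1 := D.y_lt_one hδ
  refine tendsto_div_of_abs_sub_le hL tendsto_log_one_div_one_sub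
    (K := |Real.log ((1 - D.y δ) / (δ * D.y δ) / 2)|
      + |Real.log ((1 - D.y δ) / (δ * D.y δ) + 1)|) ?_
  filter_upwards [eventually_mem_Ico_half] with lam hlam
  rw [mTilde, div_mul_cancel₀ _ hL.ne']
  obtain ⟨hl0, hl1⟩ := hlam
  set y := D.y δ
  set b := (1 - y) / (δ * y) with hb
  have hb0 : 0 < b := div_pos (by linarith) (by positivity)
  have hp : 0 < 1 - lam := by linarith
  have harg : 1 / y + (lam / (δ * (1 - lam)) - 1) * ((1 - y) / y)
      = 1 / (1 - lam) * (b * lam + (1 - lam)) := by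
    rw [hb]
    field_simp
    ring
  have hpos : 0 < b * lam + (1 - lam) := by positivity
  rw [harg, Real.log_mul (by positivity) hpos.ne', add_sub_cancel_left]
  have h1 : b / 2 ≤ b * lam + (1 - lam) := by nlinarith
  have h2 : b * lam + (1 - lam) ≤ b + 1 := by nlinarith
  have h3 := Real.log_le_log (by positivity) h1
  have h4 := Real.log_le_log hpos h2
  rw [abs_le]
  have h5 := neg_abs_le (Real.log (b / 2))
  have h6 := le_abs_self (Real.log (b + 1))
  have h7 := abs_nonneg (Real.log (b / 2))
  have h8 := abs_nonneg (Real.log (b + 1))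
  constructor <;> linarith

theorem tendsto_meanQueueLength_div_log (hD : D.mean = 1) (hδ : 0 < δ) {EQ : ℝ → ℝ}
    (h : ∀ lam ∈ Set.Ioo (0 : ℝ) 1, ∃ c : CavityQueue D δ lam, EQ lam = c.meanQueueLength) :
    Tendsto (fun lam => EQ lam / Real.log (1 / (1 - lam))) (𝓝[<] 1)
      (𝓝 (1 / Real.log (1 / D.y δ))) := by
  have hL := log_one_div_y_pos (D := D) hδ
  refine tendsto_div_of_abs_sub_le hL tendsto_log_one_div_one_sub
    (K := (1 / δ + 1) * Real.log (1 / D.y δ) + (|Real.log ((1 - D.y δ) / δ / 2)|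
      + |Real.log (((1 - D.y δ) / δ + D.y δ) / D.y δ)|)) ?_
  filter_upwards [eventually_mem_Ico_half] with lam hlam
  obtain ⟨c, hc⟩ := h lam ⟨by linarith [hlam.1], hlam.2⟩
  have h1 := c.abs_m_mul_log_sub_le hD hδ hlam
  have h2 : |EQ lam - c.m| ≤ 1 / δ + 1 := by
    have h3 := c.meanQueueLength_le
    have h4 := c.le_meanQueueLength hD hδ
    have h5 : lam / δ ≤ 1 / δ := by
      gcongr
      exact hlam.2.le
    have h6 : 0 < 1 / δ := by positivity
    rw [hc, abs_le]
    constructor <;> linarith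
  have h3 : EQ lam * Real.log (1 / D.y δ) - Real.log (1 / (1 - lam))
      = (EQ lam - c.m) * Real.log (1 / D.y δ)
        + (c.m * Real.log (1 / D.y δ) - Real.log (1 / (1 - lam))) := by ring
  rw [h3]
  refine (abs_add_le _ _).trans (add_le_add ?_ h1)
  rw [abs_mul, abs_of_pos hL]
  exact mul_le_mul_of_nonneg_right h2 hL.le

end Asymptotics

theorem mainTheorem7 {n : ℕ} (D : PhaseType n) (hD : D.mean = 1) (δ : ℝ) (hδ : 0 < δ) :
    (∀ lam ∈ Set.Ioo (0 : ℝ) 1, Nonempty (CavityQueue D δ lam)) ∧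
    ∀ EQ ER : ℝ → ℝ,
      (∀ lam ∈ Set.Ioo (0 : ℝ) 1, ∃ c : CavityQueue D δ lam,
        EQ lam = c.meanQueueLength ∧ ER lam = c.meanResponseTime) →
      Filter.Tendsto (fun lam => ER lam / Real.log (1 / (1 - lam)))
          (nhdsWithin 1 (Set.Iio 1)) (nhds (1 / Real.log (1 / D.y δ))) ∧
      Filter.Tendsto (fun lam => EQ lam / Real.log (1 / (1 - lam)))
          (nhdsWithin 1 (Set.Iio 1)) (nhds (1 / Real.log (1 / D.y δ))) ∧
      Filter.Tendsto (fun lam => mTilde D δ lam / Real.log (1 / (1 - lam)))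
          (nhdsWithin 1 (Set.Iio 1)) (nhds (1 / Real.log (1 / D.y δ))) := by
  refine ⟨fun lam hlam => nonempty_cavityQueue hD hδ hlam, fun EQ ER h => ?_⟩
  have hEQ := tendsto_meanQueueLength_div_log hD hδ fun lam hlam =>
    (h lam hlam).imp fun c hc => hc.1
  refine ⟨?_, hEQ, tendsto_mTilde_div_log D hδ⟩
  have hid : Filter.Tendsto (fun lam : ℝ => lam) (nhdsWithin 1 (Set.Iio 1)) (nhds 1) :=
    nhdsWithin_le_nhds
  have hdiv := hEQ.div hid one_ne_zero
  rw [div_one] at hdiv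
  refine hdiv.congr' ?_
  filter_upwards [eventually_mem_Ico_half] with lam hlam
  obtain ⟨c, hc, hc'⟩ := h lam ⟨by linarith [hlam.1], hlam.2⟩
  rw [Pi.div_apply, hc', c.meanResponseTime_eq hD, ← hc, div_right_comm]
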